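/- Let $n\ge 0$ be an integer and let $c_{ij}\ge 0$ ($1\le i<j\le n$) be real constants, $\mathcal D=(c_{ij})$. Let $I=\{a,1,\dots,n,b\}$, ordered by $a<1<\dots<n<b$, and let $\mathcal K^n$ be the space of real arrays $(s_{ij})_{i,j\in I}$ with $s_{ii}=0$, $s_{ij}=s_{ji}$ and $\sum_{j\ne i}s_{ij}=0$ for all $i\in I$. Let $\mathcal K^n(\mathcal D)$ be the affine subspace of $\mathcal K^n$ given by $s_{ij}=-c_{ij}$ for $1\le i<j\le n$. For $J\subseteq I$ put $s_J=\sum_{i,j\in J,\ i<j}s_{ij}$, and for $S\subseteq\{1,\dots,n\}$ write $s_{aS}=s_{\{a\}\cup S}$. An ordered set partition $\mathbf T=(S_1,\dots,S_k)$ of $\{1,\dots,n\}$ is a sequence of pairwise disjoint nonempty sets with union $\{1,\dots,n\}$, and $\mathrm{len}(\mathbf T)=k$. Let $[[\mathbf T]]_{\mathcal D}$ be the indicator function of the cone of all $s\in\mathcal K^n(\mathcal D)$ with $s_{aS_1\cup\dots\cup S_m}\ge 0$ for $1\le m\le k-1$ and $s_{a12\cdots n}=0$ (the last equation holds identically on $\mathcal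 K^n$). Let $\mathcal Z_{\mathcal D}\subset\mathbb R^n$ be the Minkowski sum over all $i<j$ of the segments $\{c_{ij}(te_i+(1-t)e_j):0\le t\le 1\}$. Then the map $s\mapsto (s_{a1},\dots,s_{an})$ restricts to a bijection from $\mathcal K^n(\mathcal D)$ onto the affine hyperplane $\{x\in\mathbb R^n:\sum_i x_i=\sum_{i<j}c_{ij}\}$ (all of $\mathbb R^0$ if $n=0$), this hyperplane contains $\mathcal Z_{\mathcal D}$, and, when $\mathcal Z_{\mathcal D}$ is regarded in this way as a subset of $\mathcal K^n(\mathcal D)$, its indicator function satisfies $$[\mathcal Z_{\mathcal D}]=\sum_{\mathbf T}(-1)^{n-\mathrm{len}(\mathbf T)}\,[[\mathbf T]]_{\mathcal D},$$ where $\mathbf T$ runs over all ordered set partitions of $\{1,\dots,n\}$. -/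

import Mathlib

open scoped BigOperators Pointwise

namespace Kinematic

/-! ## Index set

The particle labels `a, 1, …, n, b` are the elements of `Fin (n + 2)` in increasing order. -/

/-- The auxiliary label `a`, the first element of the index set. -/
def labelA (n : ℕ) : Fin (n + 2) := 0

/-- The label in `{1, …, n}` given by `i : Fin n`, strictly between `a` and `b`. -/
def label {n : ℕ} (i : Fin n) : Fin (n + 2) := i.castSucc.succ

/-- For `J ⊆ {1, …, n}`, the set of labels `{a} ∪ J`. -/
def withA {n : ℕ} (J : Finset (Fin n)) : Finset (Fin (n + 2)) :=
  insert (labelA n) (J.image label)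

/-! ## Kinematic space -/

/-- The kinematic space: symmetric `(n + 2) × (n + 2)` real arrays with zero diagonal such that,
for each `i`, the sum of the `s i j` over `j ≠ i` vanishes. -/
def kinematicSpace (n : ℕ) : Submodule ℝ (Fin (n + 2) → Fin (n + 2) → ℝ) where
  carrier := {s | (∀ i, s i i = 0) ∧ (∀ i j, s i j = s j i) ∧
    ∀ i, ∑ j ∈ Finset.univ.filter (fun j => j ≠ i), s i j = 0}
  add_mem' := by
    rintro s t ⟨hs1, hs2, hs3⟩ ⟨ht1, ht2, ht3⟩
    refine ⟨fun i => by simp [hs1 i, ht1 i], fun i j => ?_, fun i => ?_⟩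
    · simp only [Pi.add_apply]
      rw [hs2 i j, ht2 i j]
    · simp only [Pi.add_apply, Finset.sum_add_distrib]
      rw [hs3 i, ht3 i, add_zero]
  zero_mem' := ⟨fun _ => rfl, fun _ _ => rfl, fun _ => by simp⟩
  smul_mem' := by
    rintro r s ⟨hs1, hs2, hs3⟩
    refine ⟨fun i => by simp [hs1 i], fun i j => ?_, fun i => ?_⟩
    · simp only [Pi.smul_apply]
      rw [hs2 i j]
    · simp only [Pi.smul_apply, ← Finset.smul_sum]
      rw [hs3 i, smul_zero]

/-- The affine subspace of the kinematic space cut out by `s_{ij} = - c_{ij}`, `1 ≤ i < j ≤ n`.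
Only the entries `c i j` with `i < j` of the matrix of constants are used. -/
def kinematicSlice {n : ℕ} (c : Fin n → Fin n → ℝ) : Set (Fin (n + 2) → Fin (n + 2) → ℝ) :=
  {s | s ∈ kinematicSpace n ∧ ∀ i j, i < j → s (label i) (label j) = -c i j}

/-- `s_J`, the sum of `s_{ij}` over all `i < j` in `J`. -/
def mandelstam {n : ℕ} (s : Fin (n + 2) → Fin (n + 2) → ℝ) (J : Finset (Fin (n + 2))) : ℝ :=
  ∑ p ∈ (J ×ˢ J).filter (fun p => p.1 < p.2), s p.1 p.2

/-- The coordinates `x_i = s_{ai}`, `1 ≤ i ≤ n`. -/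
def coord {n : ℕ} (s : Fin (n + 2) → Fin (n + 2) → ℝ) : Fin n → ℝ :=
  fun i => s (labelA n) (label i)

/-! ## Ordered set partitions and their cones -/

/-- An ordered set partition `(S_1, …, S_k)` of `{1, …, n}`: a finite sequence of pairwise
disjoint nonempty blocks whose union is everything. -/
@[ext]
structure OrderedSetPartition (n : ℕ) where
  /-- the number `k` of blocks -/
  len : ℕ
  /-- the sequence of blocks -/
  block : Fin len → Finset (Fin n)
  nonempty : ∀ j, (block j).Nonempty
  disjoint : ∀ i j, i ≠ j → Disjoint (block i) (block j)
  cover : ∀ x, ∃ j, x ∈ block j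

namespace OrderedSetPartition

/-- An ordered set partition of `{1, …, n}` has at most `n` blocks. -/
theorem len_le {n : ℕ} (T : OrderedSetPartition n) : T.len ≤ n := by
  choose f hf using T.nonempty
  have hinj : Function.Injective f := by
    intro i j hij
    by_contra hne
    exact Finset.disjoint_left.mp (T.disjoint i j hne) (hf i) (hij ▸ hf j)
  simpa using Fintype.card_le_of_injective f hinj

instance finite (n : ℕ) : Finite (OrderedSetPartition n) := by
  let F : OrderedSetPartition n → Σ k : Fin (n + 1), (Fin k.val → Finset (Fin n)) :=
    fun T => ⟨⟨T.len, Nat.lt_succ_of_le T.len_le⟩, T.block⟩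
  refine Finite.of_injective F ?_
  rintro ⟨k, S, h1, h2, h3⟩ ⟨k', S', h1', h2', h3'⟩ h
  simp only [F, Sigma.mk.injEq, Fin.mk.injEq] at h
  obtain ⟨rfl, h⟩ := h
  obtain rfl := eq_of_heq h
  rfl

noncomputable instance fintype (n : ℕ) : Fintype (OrderedSetPartition n) := Fintype.ofFinite _

/-- The union `S_1 ∪ ⋯ ∪ S_m` of the first `m` blocks. -/
def initialUnion {n : ℕ} (T : OrderedSetPartition n) (m : ℕ) : Finset (Fin n) :=
  (Finset.univ.filter (fun j : Fin T.len => j.val < m)).biUnion T.block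

end OrderedSetPartition

/-- The cone in the slice attached to `(S_1, …, S_k)`: the points with
`s_{a S_1 ∪ ⋯ ∪ S_m} ≥ 0` for `1 ≤ m ≤ k - 1` and `s_{a 1 2 ⋯ n} = 0`. -/
def flagCone {n : ℕ} (c : Fin n → Fin n → ℝ) (T : OrderedSetPartition n) :
    Set (Fin (n + 2) → Fin (n + 2) → ℝ) :=
  {s | s ∈ kinematicSlice c ∧
    (∀ m, 1 ≤ m → m < T.len → 0 ≤ mandelstam s (withA (T.initialUnion m))) ∧
    mandelstam s (withA Finset.univ) = 0}

/-! ## The zonotope -/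

/-- The dilated root interval `{r (t e_i + (1 - t) e_j) : 0 ≤ t ≤ 1}`. -/
def rootInterval {n : ℕ} (r : ℝ) (i j : Fin n) : Set (Fin n → ℝ) :=
  {x | ∃ t : ℝ, 0 ≤ t ∧ t ≤ 1 ∧
    x = r • (t • (Pi.single i 1 : Fin n → ℝ) + (1 - t) • (Pi.single j 1 : Fin n → ℝ))}

/-- The zonotopal generalized permutohedron in `ℝⁿ`: the Minkowski sum of the root intervals
dilated by `c i j`, over all `i < j`. -/
noncomputable def zonotope {n : ℕ} (c : Fin n → Fin n → ℝ) : Set (Fin n → ℝ) :=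
  ∑ p ∈ Finset.univ.filter (fun p : Fin n × Fin n => p.1 < p.2), rootInterval (c p.1 p.2) p.1 p.2

/-- The affine hyperplane `x_1 + ⋯ + x_n = ∑_{i < j} c_{ij}` in `ℝⁿ`. -/
def coordHyperplane {n : ℕ} (c : Fin n → Fin n → ℝ) : Set (Fin n → ℝ) :=
  {x | ∑ i, x i = ∑ p ∈ Finset.univ.filter (fun p : Fin n × Fin n => p.1 < p.2), c p.1 p.2}

/-- The zonotope regarded as a subset of the slice through the coordinates `x_i = s_{ai}`. -/
def kinematicZonotope {n : ℕ} (c : Fin n → Fin n → ℝ) :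
    Set (Fin (n + 2) → Fin (n + 2) → ℝ) :=
  {s | s ∈ kinematicSlice c ∧ coord s ∈ zonotope c}

end Kinematic

/-!
On the slice, `s_{aJ} = x(J) - ∑_{i < j in J} c_{ij}` for `x_i = s_{ai}`
(`Kinematic.mandelstam_withA`). Call the right-hand side the excess `g(J)` of `x` on `J`. As the
`c_{ij}` are nonnegative, `g` is submodular, and `g` vanishes on the empty set and on the full set.
The proof combines two facts.

The zonotope is the part of the hyperplane where `g ≥ 0` on all sets. That `g ≥ 0` on the
zonotope can be checked on each root interval. Conversely, a point outside of the zonotope is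
separated from it by a linear functional `y`. The minimum of `y` over the zonotope is
`∑_{i < j} c_{ij} min(y_i, y_j)`, and `y(x)` minus this minimum is the integral over `t` of
`g({i | y_i ≥ t})`, hence nonnegative if `g` is (`sum_mul_min_le`).

The alternating sum at `x` is a signed sum over the chains of sets on which `g ≥ 0`
(`sum_orderedSetPartition`). By Möbius inversion on the Boolean lattice it equals `1` minus a
similar sum over chains of sets on which `g < 0` (`chainSum_eq_one_sub`). If there are no such sets
it is `1`. Otherwise let `A` minimize `g`; then `g(A) < 0`, and submodularity gives
`g(K ∪ A) ≤ g(K)` for all `K`, so the sets with `g < 0` are closed under joining with `A`. The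
poset they form is contractible through `K ≤ K ∪ A ≥ A`, which makes the alternating sum vanish
(`chainSum_eq_zero`, `chainSum_submodular`).
-/

open scoped BigOperators Pointwise

/-! ### Signed sums over chains of subsets -/

section Chains

variable {α : Type*} [Fintype α] [DecidableEq α]

open Classical in
/-- The signed weight, relative to a family `p` of sets, of a sequence `S_1, …, S_k` of blocks to
be adjoined one after the other to the set `J`. If the blocks are nonempty, pairwise disjoint,
disjoint from `J` and together with `J` cover everything, and if all the sets
`J ∪ S_1 ∪ ⋯ ∪ S_m` with `1 ≤ m ≤ k` (the full set included) belong to `p`, the weight is the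
product of the signs `(-1) ^ (|S_m| + 1)`. Otherwise it is `0`. -/
noncomputable def chainWeight (p : Finset α → Prop) :
    (k : ℕ) → Finset α → (Fin k → Finset α) → ℤ
  | 0, J, _ => if J = Finset.univ then 1 else 0
  | k + 1, J, S =>
    if (S 0).Nonempty ∧ Disjoint J (S 0) ∧ p (J ∪ S 0) then
      (-1) ^ ((S 0).card + 1) * chainWeight p k (J ∪ S 0) (Fin.tail S) else 0

/-- The sum of `chainWeight` over all block sequences of all lengths, that is, the signed sum over
the chains from `J` up to the full set whose members above `J` belong to `p`. Longer sequences than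
the size of the ground set have weight `0`, so the range of lengths is harmless. -/
noncomputable def chainSum (p : Finset α → Prop) (J : Finset α) : ℤ :=
  ∑ k ∈ Finset.range (Fintype.card α + 1), ∑ S : Fin k → Finset α, chainWeight p k J S

theorem chainWeight_eq_zero_of_card_lt (p : Finset α → Prop) {k : ℕ} {J : Finset α}
    (S : Fin k → Finset α) (h : Fintype.card α < k + J.card) : chainWeight p k J S = 0 := by
  induction k generalizing J with
  | zero =>
    have := J.card_le_univ
    omega
  | succ k ih =>
    rw [chainWeight]
    split_ifs with hS
    · obtain ⟨hne, hd, -⟩ := hS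
      have := hne.card_pos
      rw [ih, mul_zero]
      rw [Finset.card_union_of_disjoint hd]
      omega
    · rfl

open Classical in
/-- Splitting off the first block `A` amounts to choosing the first member `K = J ∪ A` of the chain
above `J`. -/
theorem sum_chainWeight_succ (p : Finset α → Prop) (k : ℕ) (J : Finset α) :
    ∑ S : Fin (k + 1) → Finset α, chainWeight p (k + 1) J S =
      ∑ K with J ⊂ K, if p K then
        (-1) ^ ((K \ J).card + 1) * ∑ S : Fin k → Finset α, chainWeight p k K S else 0 := by
  rw [← (Fin.consEquiv fun _ => Finset α).sum_comp, Fintype.sum_prod_type]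
  simp only [Fin.consEquiv_apply, chainWeight, Fin.cons_zero]
  rw [← Finset.sum_filter_add_sum_filter_not Finset.univ
    (fun A : Finset α => A.Nonempty ∧ Disjoint J A)]
  rw [Finset.sum_eq_zero (s := Finset.univ.filter
    (fun A : Finset α => ¬(A.Nonempty ∧ Disjoint J A))), add_zero]
  · refine Finset.sum_nbij' (fun A => J ∪ A) (fun K => K \ J) ?_ ?_ ?_ ?_ ?_
    · simp only [Finset.mem_filter, Finset.mem_univ, true_and]
      rintro A ⟨⟨a, ha⟩, hd⟩
      refine Finset.ssubset_iff_subset_ne.2 ⟨Finset.subset_union_left, fun h => ?_⟩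
      exact Finset.disjoint_right.1 hd ha (h ▸ Finset.mem_union_right _ ha)
    · simp only [Finset.mem_filter, Finset.mem_univ, true_and]
      exact fun K hK => ⟨Finset.sdiff_nonempty.2 hK.2, Finset.disjoint_sdiff⟩
    · simp only [Finset.mem_filter, Finset.mem_univ, true_and]
      exact fun A hA => Finset.union_sdiff_cancel_left hA.2
    · simp only [Finset.mem_filter, Finset.mem_univ, true_and]
      exact fun K hK => Finset.union_sdiff_of_subset hK.1
    · simp only [Finset.mem_filter, Finset.mem_univ, true_and]
      intro A hA
      simp only [hA.1, hA.2, true_and, Finset.union_sdiff_cancel_left hA.2]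
      split_ifs
      · rw [Finset.mul_sum]
        rfl
      · simp
  · simp only [Finset.mem_filter, Finset.mem_univ, true_and]
    intro A hA
    exact Finset.sum_eq_zero fun S _ => if_neg fun h => hA ⟨h.1, h.2.1⟩

open Classical in
theorem chainSum_eq (p : Finset α → Prop) (J : Finset α) :
    chainSum p J = (if J = Finset.univ then 1 else 0) +
      ∑ K with J ⊂ K, if p K then (-1) ^ ((K \ J).card + 1) * chainSum p K else 0 := by
  rw [chainSum, Finset.sum_range_succ', add_comm]
  congr 1
  · simp [chainWeight]
  · simp only [sum_chainWeight_succ]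
    rw [Finset.sum_comm]
    refine Finset.sum_congr rfl fun K hK => ?_
    have hpos : 0 < K.card :=
      (Nat.zero_le _).trans_lt (Finset.card_lt_card (Finset.mem_filter.1 hK).2)
    split_ifs
    · rw [← Finset.mul_sum, chainSum, Finset.sum_range_succ, Finset.sum_eq_zero
        (fun S _ => chainWeight_eq_zero_of_card_lt p S (by omega)), add_zero]
    · simp

theorem sum_neg_one_pow_card_sdiff (J L : Finset α) :
    ∑ K with J ⊆ K ∧ K ⊆ L, (-1 : ℤ) ^ (L \ K).card = if L = J then 1 else 0 := by
  by_cases hJL : J ⊆ L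
  · have : ∑ K with J ⊆ K ∧ K ⊆ L, (-1 : ℤ) ^ (L \ K).card =
        ∑ A ∈ (L \ J).powerset, (-1 : ℤ) ^ A.card := by
      refine Finset.sum_nbij' (fun K => L \ K) (fun A => L \ A) ?_ ?_ ?_ ?_ ?_
      · simp only [Finset.mem_filter, Finset.mem_univ, true_and, Finset.mem_powerset]
        exact fun K hK => Finset.sdiff_subset_sdiff le_rfl hK.1
      · simp only [Finset.mem_filter, Finset.mem_univ, true_and, Finset.mem_powerset]
        refine fun A hA => ⟨fun i hi => ?_, Finset.sdiff_subset⟩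
        exact Finset.mem_sdiff.2 ⟨hJL hi, fun h => (Finset.mem_sdiff.1 (hA h)).2 hi⟩
      · simp only [Finset.mem_filter, Finset.mem_univ, true_and]
        exact fun K hK => Finset.sdiff_sdiff_eq_self hK.2
      · simp only [Finset.mem_powerset]
        exact fun A hA => Finset.sdiff_sdiff_eq_self (hA.trans Finset.sdiff_subset)
      · intros; rfl
    rw [this, Finset.sum_powerset_neg_one_pow_card]
    refine if_congr ?_ rfl rfl
    rw [Finset.sdiff_eq_empty_iff_subset]
    exact ⟨fun h => h.antisymm hJL, fun h => h.le⟩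
  · rw [if_neg (fun h => hJL h.ge), Finset.sum_eq_zero]
    simp only [Finset.mem_filter, Finset.mem_univ, true_and]
    exact fun K hK => absurd (hK.1.trans hK.2) hJL

/-- Möbius inversion on the Boolean lattice, summing over supersets. -/
theorem superset_moebius_inversion (h : Finset α → ℤ) (J : Finset α) :
    ∑ K with J ⊆ K, ∑ L with K ⊆ L, (-1 : ℤ) ^ (L \ K).card * h L = h J := by
  have : ∑ K with J ⊆ K, ∑ L with K ⊆ L, (-1 : ℤ) ^ (L \ K).card * h L =
      ∑ L, (∑ K with J ⊆ K ∧ K ⊆ L, (-1 : ℤ) ^ (L \ K).card) * h L := by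
    simp only [Finset.sum_mul]
    exact Finset.sum_comm' (by simp)
  rw [this]
  simp [sum_neg_one_pow_card_sdiff]

theorem filter_subset_eq_insert (J : Finset α) :
    (Finset.univ.filter fun K => J ⊆ K) = insert J (Finset.univ.filter fun K => J ⊂ K) := by
  ext K
  simp only [Finset.mem_filter, Finset.mem_univ, true_and, Finset.mem_insert]
  rw [eq_comm]
  exact le_iff_eq_or_lt

open Classical in
/-- Möbius inversion turns the recursion `chainSum_eq` over the sets in `p` into one over the sets
not in `p`: up to sign, chains that lie in `p` are traded for chains that avoid it. -/
theorem chainSum_eq_one_sub (p : Finset α → Prop) (J : Finset α) :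
    chainSum p J = 1 - ∑ K with J ⊂ K, if p K then 0 else chainSum p K := by
  have key : ∀ K : Finset α, ∑ L with K ⊆ L, (-1 : ℤ) ^ (L \ K).card *
      (if p L then chainSum p L else 0) =
      (if K = Finset.univ then 1 else 0) - if p K then 0 else chainSum p K := by
    intro K
    have h1 := chainSum_eq p K
    rw [filter_subset_eq_insert, Finset.sum_insert (by simp)]
    have h2 : ∑ L with K ⊂ L, (-1 : ℤ) ^ (L \ K).card * (if p L then chainSum p L else 0) =
        - ∑ L with K ⊂ L, if p L then (-1) ^ ((L \ K).card + 1) * chainSum p L else 0 := by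
      rw [← Finset.sum_neg_distrib]
      refine Finset.sum_congr rfl fun L _ => ?_
      split_ifs <;> ring
    rw [h2]
    simp only [sdiff_self, Finset.bot_eq_empty, Finset.card_empty, pow_zero, one_mul]
    by_cases hK : p K <;> simp only [hK, if_true, if_false] <;> linarith
  have inv := superset_moebius_inversion (fun L => if p L then chainSum p L else 0) J
  simp only [key, Finset.sum_sub_distrib] at inv
  rw [Finset.sum_ite_eq' ] at inv
  rw [filter_subset_eq_insert, Finset.sum_insert (by simp)] at inv
  have hm : Finset.univ ∈ insert J (Finset.univ.filter fun K => J ⊂ K) := by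
    rw [← filter_subset_eq_insert]; simp
  rw [if_pos hm] at inv
  by_cases hJ : p J <;> simp only [hJ, if_true, if_false] at inv <;> linarith

/-- If joining with `A` preserves the complement of `p`, then that complement is conically
contractible through `K ≤ K ∪ A ≥ A`, and the signed sum over chains vanishes at every `J` that
does not contain `A` and whose join with `A` is not in `p`. -/
theorem chainSum_eq_zero (p : Finset α → Prop) {A : Finset α}
    (hA : ∀ K, ¬ p K → ¬ p (K ∪ A)) {J : Finset α} (hJ : ¬ A ⊆ J) (hJA : ¬ p (J ∪ A)) :
    chainSum p J = 0 := by
  classical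
  induction J using (wellFounded_gt (α := Finset α)).induction with
  | _ J ih =>
  rw [chainSum_eq_one_sub p J]
  -- By induction only the supersets of `J ∪ A` contribute to the recursion at `J`, and these
  -- contribute `1` in total by the recursion at `J ∪ A`, which is not in `p`.
  have h1 := chainSum_eq_one_sub p (J ∪ A)
  have hAe : (∑ K with J ⊂ K, if p K then 0 else chainSum p K) =
      ∑ K with J ∪ A ⊆ K, if p K then 0 else chainSum p K := by
    symm
    refine Finset.sum_subset ?_ ?_
    · intro K
      simp only [Finset.mem_filter, Finset.mem_univ, true_and]
      refine fun h => ⟨Finset.subset_union_left.trans h, fun h' => hJ ?_⟩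
      exact Finset.subset_union_right.trans (h.trans h')
    · simp only [Finset.mem_filter, Finset.mem_univ, true_and]
      intro K hK hK'
      split_ifs with hpK
      · rfl
      · refine ih K hK (fun h => hK' (Finset.union_subset hK.1 h)) (hA K hpK)
  rw [hAe, filter_subset_eq_insert, Finset.sum_insert (by simp), if_neg hJA]
  linarith

end Chains

/-- For a submodular function `g` with `g ∅ = 0`, the signed sum over chains of sets on which `g` is
nonnegative detects whether `g` is nonnegative throughout: if it is not, joining with a minimizer
of `g` preserves the sets on which `g` is negative. -/
theorem chainSum_submodular {α : Type*} [Fintype α] [DecidableEq α] (g : Finset α → ℝ)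
    (hsub : ∀ J K, g (J ∪ K) + g (J ∩ K) ≤ g J + g K)
    (h0 : g ∅ = 0) [Decidable (∀ J, 0 ≤ g J)] :
    chainSum (fun J => 0 ≤ g J) ∅ = if ∀ J, 0 ≤ g J then 1 else 0 := by
  split_ifs with h
  · rw [chainSum_eq_one_sub _]
    simp [h]
  · push Not at h
    obtain ⟨B, hB⟩ := h
    obtain ⟨A, hA⟩ := Finite.exists_min g
    have hneg : g A < 0 := (hA B).trans_lt hB
    refine chainSum_eq_zero _ (A := A) (fun K hK => ?_) (fun h => ?_) ?_
    · have := hsub K A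
      have := hA (K ∩ A)
      push Not at hK ⊢
      linarith
    · rw [Finset.subset_empty.1 h, h0] at hneg
      exact lt_irrefl _ hneg
    · simpa using hneg

/-! ### Ordered set partitions as chains -/

section Blocks
variable {α : Type*} [DecidableEq α]

/-- The union `J ∪ S_0 ∪ ⋯ ∪ S_i`, the block `S_i` included. -/
def partialUnion {k : ℕ} (J : Finset α) (S : Fin k → Finset α) (i : Fin k) : Finset α :=
  J ∪ (Finset.univ.filter (· ≤ i)).biUnion S

/-- The blocks `S_j` form an ordered set partition of the complement of `J`. -/
structure IsBlockSequence (J : Finset α) {k : ℕ} (S : Fin k → Finset α) : Prop where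
  nonempty : ∀ j, (S j).Nonempty
  disjoint : ∀ i j, i ≠ j → Disjoint (S i) (S j)
  disjoint_left : ∀ j, Disjoint J (S j)
  cover : ∀ x, x ∈ J ∨ ∃ j, x ∈ S j

theorem partialUnion_zero {k : ℕ} (J : Finset α) (S : Fin (k + 1) → Finset α) :
    partialUnion J S 0 = J ∪ S 0 := by
  ext x
  simp [partialUnion]

theorem partialUnion_succ {k : ℕ} (J : Finset α) (S : Fin (k + 1) → Finset α) (i : Fin k) :
    partialUnion J S i.succ = partialUnion (J ∪ S 0) (Fin.tail S) i := by
  ext x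
  simp [partialUnion, Fin.exists_fin_succ, Fin.tail]

theorem isBlockSequence_succ {k : ℕ} (J : Finset α) (S : Fin (k + 1) → Finset α) :
    IsBlockSequence J S ↔
      (S 0).Nonempty ∧ Disjoint J (S 0) ∧ IsBlockSequence (J ∪ S 0) (Fin.tail S) := by
  constructor
  · intro h
    refine ⟨h.nonempty 0, h.disjoint_left 0, fun j => h.nonempty _,
      fun i j hij => h.disjoint _ _ fun h' => hij (Fin.succ_injective _ h'), fun j => ?_,
      fun x => ?_⟩
    · exact Finset.disjoint_union_left.2
        ⟨h.disjoint_left _, h.disjoint _ _ (Fin.succ_ne_zero j).symm⟩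
    · have := h.cover x
      rw [Fin.exists_fin_succ] at this
      simpa [or_assoc, Fin.tail] using this
  · rintro ⟨hne, hd, h⟩
    have hl := fun j => Finset.disjoint_union_left.1 (h.disjoint_left j)
    refine ⟨Fin.cases hne h.nonempty, Fin.cases (Fin.cases (by simp) fun j _ => (hl j).2)
      fun i => Fin.cases (fun _ => (hl i).2.symm) fun j hij => h.disjoint i j (by simpa using hij),
      Fin.cases hd fun j => (hl j).1, fun x => ?_⟩
    have := h.cover x
    rw [Fin.exists_fin_succ]
    simpa [or_assoc, Fin.tail] using this

variable [Fintype α]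

open Classical in
/-- Closed form of `chainWeight`. The exponent is the sum of all `|S_j| + 1` up to a multiple of
`2`; it avoids subtraction of natural numbers. -/
theorem chainWeight_eq (p : Finset α → Prop) {k : ℕ} (J : Finset α) (S : Fin k → Finset α) :
    chainWeight p k J S = if IsBlockSequence J S ∧ ∀ i, p (partialUnion J S i) then
      (-1) ^ (Fintype.card α + J.card + k) else 0 := by
  induction k generalizing J with
  | zero =>
    have h : IsBlockSequence J S ↔ J = Finset.univ := by
      rw [Finset.eq_univ_iff_forall]
      exact ⟨fun h x => (h.cover x).resolve_right fun ⟨j, _⟩ => j.elim0,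
        fun h => ⟨fun j => j.elim0, fun j => j.elim0, fun j => j.elim0, fun x => .inl (h x)⟩⟩
    simp only [chainWeight, h, IsEmpty.forall_iff, and_true]
    split_ifs with hJ
    · rw [hJ, Finset.card_univ, add_zero, ← two_mul, pow_mul, neg_one_sq, one_pow]
    · rfl
  | succ k ih =>
    rw [chainWeight, ih]
    simp only [isBlockSequence_succ, Fin.forall_fin_succ, partialUnion_zero, partialUnion_succ]
    by_cases h : (S 0).Nonempty ∧ Disjoint J (S 0) ∧ p (J ∪ S 0)
    · obtain ⟨h1, h2, h3⟩ := h
      simp only [h1, h2, h3, true_and, and_true, if_true, mul_ite, mul_zero,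
        Finset.card_union_of_disjoint h2]
      refine if_congr Iff.rfl ?_ rfl
      rw [← pow_add, neg_one_pow_eq_pow_mod_two, neg_one_pow_eq_pow_mod_two (_ + _ + (k + 1))]
      congr 1
      omega
    · rw [if_neg h, if_neg]
      tauto

end Blocks

open Kinematic in
/-- The alternating sum over ordered set partitions is `chainSum` over the chains from the empty
set. -/
theorem sum_orderedSetPartition {n : ℕ} (p : Finset (Fin n) → Prop) (hp : p Finset.univ)
    [∀ T : OrderedSetPartition n, Decidable (∀ m, 1 ≤ m → m < T.len → p (T.initialUnion m))] :
    ∑ T : OrderedSetPartition n, (-1 : ℤ) ^ (n - T.len) *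
      (if ∀ m, 1 ≤ m → m < T.len → p (T.initialUnion m) then 1 else 0) = chainSum p ∅ := by
  have hblock (T : OrderedSetPartition n) : IsBlockSequence ∅ T.block :=
    ⟨T.nonempty, T.disjoint, fun _ => Finset.disjoint_empty_left _, fun x => .inr (T.cover x)⟩
  rw [chainSum, Finset.sum_sigma']
  refine Finset.sum_of_injOn (fun T => ⟨T.len, T.block⟩) ?_ ?_ ?_ ?_
  · rintro ⟨k, S, _, _, _⟩ - ⟨k', S', _, _, _⟩ - h
    cases h
    rfl
  · intro T _
    have := T.len_le
    simp
    omega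
  · rintro ⟨k, S⟩ - hS
    rw [chainWeight_eq, if_neg]
    rintro ⟨h, -⟩
    exact hS ⟨⟨k, S, h.nonempty, h.disjoint, fun x => (h.cover x).resolve_left (by simp)⟩,
      by simp, rfl⟩
  · intro T _
    have hsign : (-1 : ℤ) ^ (n - T.len) = (-1) ^ (n + T.len) := by
      rw [neg_one_pow_eq_pow_mod_two, neg_one_pow_eq_pow_mod_two (_ + _)]
      have := T.len_le
      congr 1
      omega
    have hU (i : Fin T.len) : partialUnion ∅ T.block i = T.initialUnion (i + 1) := by
      rw [partialUnion, Finset.empty_union, OrderedSetPartition.initialUnion]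
      congr 1
      exact Finset.filter_congr fun j _ => Nat.lt_succ_iff.symm
    have hiff : (∀ i, p (partialUnion ∅ T.block i)) ↔
        ∀ m, 1 ≤ m → m < T.len → p (T.initialUnion m) := by
      simp only [hU]
      refine ⟨fun h m h1 h2 => ?_, fun h i => ?_⟩
      · have := h ⟨m - 1, by omega⟩
        rwa [Nat.sub_add_cancel h1] at this
      rcases (Nat.succ_le_of_lt i.2).lt_or_eq with hi | hi
      · exact h _ (Nat.le_add_left 1 _) hi
      · suffices hU' : T.initialUnion (i + 1) = Finset.univ by rwa [hU']
        refine Finset.eq_univ_iff_forall.2 fun x => ?_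
        obtain ⟨j, hj⟩ := T.cover x
        refine Finset.mem_biUnion.2 ⟨j, ?_, hj⟩
        simpa [hi] using (show j.val < i.val + 1 by have := j.2; omega)
    simp [chainWeight_eq, hsign, hblock, hiff]

/-! ### The excess function and the zonotope -/

/-- The sum of `c i j` over all pairs `i < j` in `J`. -/
def internalWeight {n : ℕ} (c : Fin n → Fin n → ℝ) (J : Finset (Fin n)) : ℝ :=
  ∑ p : Fin n × Fin n with p.1 < p.2, if p.1 ∈ J ∧ p.2 ∈ J then c p.1 p.2 else 0

/-- The excess `x(J) - ∑_{i < j in J} c i j` of a point `x` on `J`. On the kinematic slice it is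
`s_{aJ}`, see `Kinematic.mandelstam_withA`. -/
def excess {n : ℕ} (c : Fin n → Fin n → ℝ) (x : Fin n → ℝ) (J : Finset (Fin n)) : ℝ :=
  ∑ i ∈ J, x i - internalWeight c J

section Excess
variable {n : ℕ} {c : Fin n → Fin n → ℝ}

theorem excess_empty (x : Fin n → ℝ) : excess c x ∅ = 0 := by
  simp [excess, internalWeight]

theorem excess_univ_eq_zero_iff (x : Fin n → ℝ) :
    excess c x Finset.univ = 0 ↔ x ∈ Kinematic.coordHyperplane c := by
  simp [excess, internalWeight, Kinematic.coordHyperplane, sub_eq_zero]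

/-- The excess is submodular, since a pair inside `J` or inside `K` is inside `J ∪ K`, and a pair
inside both is also inside `J ∩ K`. -/
theorem excess_union_add_inter_le (hc : ∀ i j, i < j → 0 ≤ c i j) (x : Fin n → ℝ)
    (J K : Finset (Fin n)) :
    excess c x (J ∪ K) + excess c x (J ∩ K) ≤ excess c x J + excess c x K := by
  have h : internalWeight c J + internalWeight c K ≤
      internalWeight c (J ∪ K) + internalWeight c (J ∩ K) := by
    simp only [internalWeight, ← Finset.sum_add_distrib]
    refine Finset.sum_le_sum fun p hp => ?_
    have := hc _ _ (Finset.mem_filter.1 hp).2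
    simp only [Finset.mem_union, Finset.mem_inter]
    by_cases h1 : p.1 ∈ J <;> by_cases h2 : p.2 ∈ J <;> by_cases h3 : p.1 ∈ K <;>
      by_cases h4 : p.2 ∈ K <;> simp [h1, h2, h3, h4, this]
  have hx := Finset.sum_union_inter (s₁ := J) (s₂ := K) (f := x)
  simp only [excess]
  linarith

theorem integral_indicator_setOf_le_one {m M v : ℝ} (hv : v ∈ Set.Icc m M) :
    ∫ t in m..M, {t | t ≤ v}.indicator (fun _ => (1 : ℝ)) t = v - m := by
  rw [intervalIntegral.integral_indicator hv]
  simp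

/-- If `x` has nonnegative excess on all sets and excess `0` on the full set, then a linear
functional `y` takes at `x` at least the value on the left, which for nonnegative `c` is its minimum
over the zonotope. The difference of the two sides is the integral over `t` of the excess of `x` on
the superlevel set `{i | t ≤ y i}`. -/
theorem sum_mul_min_le (x : Fin n → ℝ) (hx : ∀ J, 0 ≤ excess c x J)
    (hx' : excess c x Finset.univ = 0) (y : Fin n → ℝ) :
    ∑ p : Fin n × Fin n with p.1 < p.2, c p.1 p.2 * min (y p.1) (y p.2) ≤ ∑ i, x i * y i := by
  obtain ⟨M, hM⟩ : ∃ M : ℝ, ∀ i, |y i| ≤ M :=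
    ⟨∑ i, |y i|, fun i => Finset.single_le_sum (fun j _ => abs_nonneg (y j)) (Finset.mem_univ i)⟩
  have hy (i) : y i ∈ Set.Icc (-(|M|)) |M| := abs_le.1 ((hM i).trans (le_abs_self M))
  have hmin (i j) : min (y i) (y j) ∈ Set.Icc (-(|M|)) |M| :=
    ⟨le_min (hy i).1 (hy j).1, min_le_of_left_le (hy i).2⟩
  have hint (v : ℝ) : IntervalIntegrable ({t | t ≤ v}.indicator (fun _ => (1 : ℝ)))
      MeasureTheory.volume (-(|M|)) |M| := by
    refine Antitone.intervalIntegrable fun s t hst => ?_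
    simp only [Set.indicator_apply, Set.mem_ofPred_eq]
    split_ifs with h1 h2 <;> norm_num
    exact h2 (hst.trans h1)
  have hexc (t : ℝ) : excess c x {i | t ≤ y i} =
      ∑ i, x i * {t | t ≤ y i}.indicator (fun _ => (1 : ℝ)) t -
      ∑ p : Fin n × Fin n with p.1 < p.2, c p.1 p.2 *
        {t | t ≤ min (y p.1) (y p.2)}.indicator (fun _ => (1 : ℝ)) t := by
    simp [excess, internalWeight, Set.indicator_apply, Finset.sum_filter]
  have hI : 0 ≤ ∫ t in (-(|M|))..|M|, excess c x {i | t ≤ y i} :=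
    intervalIntegral.integral_nonneg (by linarith [abs_nonneg M]) fun t _ => hx _
  simp only [hexc] at hI
  have hint_sum {ι : Type} (T : Finset ι) (w v : ι → ℝ) : IntervalIntegrable
      (fun t => ∑ i ∈ T, w i * {t | t ≤ v i}.indicator (fun _ => (1 : ℝ)) t)
      MeasureTheory.volume (-(|M|)) |M| := by
    simpa only [Finset.sum_fn] using
      IntervalIntegrable.sum T fun i _ => (hint (v i)).const_mul (w i)
  rw [intervalIntegral.integral_sub (hint_sum _ _ _) (hint_sum _ _ _),
    intervalIntegral.integral_finsetSum fun i _ => (hint _).const_mul _,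
    intervalIntegral.integral_finsetSum fun p _ => (hint _).const_mul _] at hI
  simp only [intervalIntegral.integral_const_mul, integral_indicator_setOf_le_one (hy _),
    integral_indicator_setOf_le_one (hmin _ _), mul_sub, Finset.sum_sub_distrib,
    ← Finset.sum_mul] at hI
  have := (excess_univ_eq_zero_iff x).1 hx'
  rw [Kinematic.coordHyperplane, Set.mem_ofPred_eq] at this
  rw [this] at hI
  linarith

end Excess

namespace Kinematic
variable {n : ℕ}

theorem rootInterval_eq_segment (r : ℝ) (i j : Fin n) :
    rootInterval r i j =
      segment ℝ (r • (Pi.single j 1 : Fin n → ℝ)) (r • (Pi.single i 1 : Fin n → ℝ)) := by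
  ext x
  rw [segment_eq_image, rootInterval, Set.mem_ofPred_eq, Set.mem_image]
  simp only [Set.mem_Icc, and_assoc]
  refine exists_congr fun t => and_congr_right fun _ => and_congr_right fun _ => ?_
  rw [eq_comm, smul_comm (1 - t), smul_comm t, ← smul_add, add_comm]

theorem convex_zonotope (c : Fin n → Fin n → ℝ) : Convex ℝ (zonotope c) :=
  convex_sum _ fun p _ => rootInterval_eq_segment (c p.1 p.2) p.1 p.2 ▸ convex_segment _ _

theorem isCompact_zonotope (c : Fin n → Fin n → ℝ) : IsCompact (zonotope c) := by
  refine Finset.sum_induction _ IsCompact (fun _ _ => IsCompact.add) isCompact_singleton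
    fun p _ => ?_
  rw [rootInterval_eq_segment, segment_eq_image]
  exact isCompact_Icc.image (by fun_prop)

theorem excess_nonneg_of_mem_zonotope {c : Fin n → Fin n → ℝ}
    (hc : ∀ i j, i < j → 0 ≤ c i j) {x : Fin n → ℝ}
    (hx : x ∈ zonotope c) : x ∈ coordHyperplane c ∧ ∀ J, 0 ≤ excess c x J := by
  obtain ⟨z, hz, rfl⟩ := (Set.mem_finsetSum _ _ _).1 hx
  have hsum (J : Finset (Fin n)) : ∑ i ∈ J, (∑ p : Fin n × Fin n with p.1 < p.2, z p) i =
      ∑ p : Fin n × Fin n with p.1 < p.2, ∑ i ∈ J, z p i := by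
    simp only [Finset.sum_apply]
    exact Finset.sum_comm
  have hmem {p : Fin n × Fin n} (hp : p ∈ Finset.univ.filter fun p : Fin n × Fin n => p.1 < p.2)
      (J : Finset (Fin n)) : ∃ t : ℝ, 0 ≤ t ∧ t ≤ 1 ∧ ∑ i ∈ J, z p i = c p.1 p.2 *
        (t * (if p.1 ∈ J then 1 else 0) + (1 - t) * (if p.2 ∈ J then 1 else 0)) := by
    obtain ⟨t, h0, h1, ht⟩ := hz hp
    refine ⟨t, h0, h1, ?_⟩
    simp [ht, Finset.sum_add_distrib, ← Finset.mul_sum,   Pi.single_apply]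
  refine ⟨?_, fun J => ?_⟩
  · rw [coordHyperplane, Set.mem_ofPred_eq, hsum]
    refine Finset.sum_congr rfl fun p hp => ?_
    obtain ⟨t, -, -, ht⟩ := hmem hp Finset.univ
    simpa using ht
  · rw [excess, hsum, internalWeight, ← Finset.sum_sub_distrib]
    refine Finset.sum_nonneg fun p hp => ?_
    obtain ⟨t, h0, h1, ht⟩ := hmem hp J
    have hcp := hc _ _ (Finset.mem_filter.1 hp).2
    have := mul_nonneg hcp h0
    have := mul_nonneg hcp (sub_nonneg.2 h1)
    rw [ht]
    by_cases h1 : p.1 ∈ J <;> by_cases h2 : p.2 ∈ J <;> simp [h1, h2] <;> linarith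

/-- A point outside of the zonotope would be separated from it by a linear functional,
contradicting `sum_mul_min_le`. -/
theorem mem_zonotope_of_excess_nonneg {c : Fin n → Fin n → ℝ} {x : Fin n → ℝ}
    (hx : ∀ J, 0 ≤ excess c x J) (hx' : x ∈ coordHyperplane c) : x ∈ zonotope c := by
  by_contra hmem
  obtain ⟨f, u, hfu, hu⟩ := geometric_hahn_banach_point_closed (convex_zonotope c)
    (isCompact_zonotope c).isClosed hmem
  let y : Fin n → ℝ := fun i => f (Pi.single i 1)
  have hf (z : Fin n → ℝ) : f z = ∑ i, z i * y i := by
    conv_lhs => rw [pi_eq_sum_univ' z]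
    simp [y]
  -- In each summand choose the endpoint at which `f` is smaller.
  let e : Fin n × Fin n → Fin n := fun p => if y p.1 ≤ y p.2 then p.1 else p.2
  have hz : (∑ p : Fin n × Fin n with p.1 < p.2, c p.1 p.2 • (Pi.single (e p) 1 : Fin n → ℝ)) ∈
      zonotope c := by
    refine Set.finsetSum_mem_finsetSum _ _ _ fun p _ => ?_
    rw [rootInterval_eq_segment]
    by_cases h : y p.1 ≤ y p.2
    · simpa [e, h] using right_mem_segment ℝ _ _
    · simpa [e, h] using left_mem_segment ℝ _ _
  have h1 := hu _ hz
  have h2 := sum_mul_min_le x hx ((excess_univ_eq_zero_iff x).2 hx') y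
  rw [← hf] at h2
  have h3 : f (∑ p : Fin n × Fin n with p.1 < p.2, c p.1 p.2 • (Pi.single (e p) 1 : Fin n → ℝ)) =
      ∑ p : Fin n × Fin n with p.1 < p.2, c p.1 p.2 * min (y p.1) (y p.2) := by
    rw [map_sum]
    refine Finset.sum_congr rfl fun p _ => ?_
    rw [map_smul, smul_eq_mul, min_def, ← apply_ite]
  linarith

end Kinematic

/-! ### Coordinates on the kinematic slice -/

namespace Kinematic
variable {n : ℕ}

theorem label_injective : Function.Injective (label (n := n)) :=
  (Fin.succ_injective _).comp (Fin.castSucc_injective _)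

theorem mandelstam_withA {c : Fin n → Fin n → ℝ} {s : Fin (n + 2) → Fin (n + 2) → ℝ}
    (hs : s ∈ kinematicSlice c) (J : Finset (Fin n)) :
    mandelstam s (withA J) = excess c (coord s) J := by
  have h0 : labelA n ∉ J.image label := by
    simp [labelA, label]
  have hw : internalWeight c J = ∑ i ∈ J, ∑ j ∈ J, if i < j then c i j else 0 := by
    rw [internalWeight, Finset.sum_filter, Fintype.sum_prod_type]
    simp only [← Finset.sum_product']
    symm
    refine Finset.sum_subset_zero_on_sdiff
      (Finset.product_subset_product J.subset_univ J.subset_univ)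
      (fun p hp => ?_) fun p hp => ?_
    · have := (Finset.mem_sdiff.1 hp).2
      rw [Finset.mem_product] at this
      simp [this]
    · rw [Finset.mem_product] at hp
      simp [hp]
  rw [mandelstam, Finset.sum_filter, Finset.sum_product, withA]
  simp only [Finset.sum_insert h0, Finset.sum_image label_injective.injOn]
  rw [excess, hw, sub_eq_add_neg, ← Finset.sum_neg_distrib]
  congr 1
  · simp [labelA, label, coord]
  · refine Finset.sum_congr rfl fun i _ => ?_
    rw [← Finset.sum_neg_distrib, if_neg (by simp [labelA]), zero_add]
    refine Finset.sum_congr rfl fun j _ => ?_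
    have : label i < label j ↔ i < j := by simp [label]
    rw [if_congr this rfl rfl]
    split_ifs with h
    · exact hs.2 i j h
    · simp

/-- The symmetric array with zero diagonal whose entries above the diagonal are those of `c`. The
entries of `c` on and below the diagonal are not used. -/
def symmetrize (c : Fin n → Fin n → ℝ) (i j : Fin n) : ℝ :=
  if i < j then c i j else if j < i then c j i else 0

theorem symmetrize_comm (c : Fin n → Fin n → ℝ) (i j : Fin n) :
    symmetrize c i j = symmetrize c j i := by
  rcases lt_trichotomy i j with h | h | h <;> simp [symmetrize, h, h.not_gt]

theorem sum_symmetrize (c : Fin n → Fin n → ℝ) :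
    ∑ i, ∑ j, symmetrize c i j =
      2 * ∑ p : Fin n × Fin n with p.1 < p.2, c p.1 p.2 := by
  have h (i j) : symmetrize c i j = (if i < j then c i j else 0) + if j < i then c j i else 0 := by
    rcases lt_trichotomy i j with h | h | h <;> simp [symmetrize, h, h.not_gt]
  simp only [h, Finset.sum_add_distrib]
  rw [Finset.sum_comm (f := fun i j => if j < i then c j i else 0), Finset.sum_filter,
    Fintype.sum_prod_type, two_mul]

theorem mem_kinematicSpace_iff {s : Fin (n + 2) → Fin (n + 2) → ℝ} :
    s ∈ kinematicSpace n ↔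
      (∀ i, s i i = 0) ∧ (∀ i j, s i j = s j i) ∧ ∀ i, ∑ j, s i j = 0 := by
  refine and_congr_right fun h => and_congr_right fun _ => forall_congr' fun i => ?_
  rw [Finset.filter_ne', ← Finset.add_sum_erase _ _ (Finset.mem_univ i), h i, zero_add]

/-- The auxiliary label `b`, the last element of the index set. -/
def labelB (n : ℕ) : Fin (n + 2) := (Fin.last n).succ

theorem sum_labels (f : Fin (n + 2) → ℝ) :
    ∑ j, f j = f (labelA n) + ∑ i, f (label i) + f (labelB n) := by
  rw [Fin.sum_univ_succ, Fin.sum_univ_castSucc, ← add_assoc]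
  rfl

theorem forall_labels {P : Fin (n + 2) → Prop} :
    (∀ j, P j) ↔ P (labelA n) ∧ (∀ i, P (label i)) ∧ P (labelB n) := by
  rw [Fin.forall_fin_succ, Fin.forall_fin_succ']
  rfl

/-- The array with `s_{ai} = x_i` and `s_{ij} = -c_{ij}` whose entries in the column `b` are those
forced by the vanishing of the sums of the rows `a, 1, …, n`. The row `b` then sums to zero only
for `x` in the hyperplane. -/
def ofCoord (c : Fin n → Fin n → ℝ) (x : Fin n → ℝ) : Fin (n + 2) → Fin (n + 2) → ℝ :=
  Fin.cons (Fin.cons 0 (Fin.snoc x (-∑ i, x i)))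
    (Fin.snoc (α := fun _ => Fin (n + 2) → ℝ)
      (fun i => Fin.cons (x i) (Fin.snoc (fun j => -symmetrize c i j)
        (-x i + ∑ j, symmetrize c i j)))
      (Fin.cons (-∑ i, x i) (Fin.snoc (fun i => -x i + ∑ j, symmetrize c i j) 0)))

section OfCoord
variable (c : Fin n → Fin n → ℝ) (x : Fin n → ℝ) (i j : Fin n)

@[simp] theorem ofCoord_A_A : ofCoord c x (labelA n) (labelA n) = 0 := rfl
@[simp] theorem ofCoord_A_label : ofCoord c x (labelA n) (label i) = x i := by
  simp [ofCoord, labelA, label]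
@[simp] theorem ofCoord_A_B : ofCoord c x (labelA n) (labelB n) = -∑ i, x i := by
  simp [ofCoord, labelA, labelB]
@[simp] theorem ofCoord_label_A : ofCoord c x (label i) (labelA n) = x i := by
  simp [ofCoord, labelA, label]
@[simp] theorem ofCoord_label_label :
    ofCoord c x (label i) (label j) = -symmetrize c i j := by
  simp [ofCoord, label]
@[simp] theorem ofCoord_label_B :
    ofCoord c x (label i) (labelB n) = -x i + ∑ j, symmetrize c i j := by
  simp [ofCoord, label, labelB]
@[simp] theorem ofCoord_B_A : ofCoord c x (labelB n) (labelA n) = -∑ i, x i := by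
  simp [ofCoord, labelA, labelB]
@[simp] theorem ofCoord_B_label :
    ofCoord c x (labelB n) (label i) = -x i + ∑ j, symmetrize c i j := by
  simp [ofCoord, label, labelB]
@[simp] theorem ofCoord_B_B : ofCoord c x (labelB n) (labelB n) = 0 := by
  simp [ofCoord, labelB]

end OfCoord

theorem label_label_of_mem_kinematicSlice {c : Fin n → Fin n → ℝ}
    {s : Fin (n + 2) → Fin (n + 2) → ℝ} (hs : s ∈ kinematicSlice c) (i j : Fin n) :
    s (label i) (label j) = -symmetrize c i j := by
  rcases lt_trichotomy i j with h | rfl | h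
  · rw [hs.2 i j h, symmetrize, if_pos h]
  · simp [symmetrize, hs.1.1]
  · rw [hs.1.2.1, hs.2 j i h, symmetrize_comm, symmetrize, if_pos h]

theorem eq_ofCoord {c : Fin n → Fin n → ℝ} {s : Fin (n + 2) → Fin (n + 2) → ℝ}
    (hs : s ∈ kinematicSlice c) : s = ofCoord c (coord s) := by
  obtain ⟨hd, hsymm, hsum⟩ := mem_kinematicSpace_iff.1 hs.1
  simp only [sum_labels] at hsum
  have hA (i) : s (label i) (labelA n) = coord s i := hsymm _ _
  have hAB : s (labelA n) (labelB n) = -∑ i, coord s i := by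
    have := hsum (labelA n)
    rw [hd, zero_add] at this
    exact eq_neg_of_add_eq_zero_right this
  have hiB (i) : s (label i) (labelB n) = -coord s i + ∑ j, symmetrize c i j := by
    have := hsum (label i)
    simp only [label_label_of_mem_kinematicSlice hs, hA, Finset.sum_neg_distrib] at this
    linarith
  simp only [funext_iff, forall_labels]
  refine ⟨⟨?_, fun i => ?_, ?_⟩, fun i => ⟨?_, fun j => ?_, ?_⟩, ?_, fun i => ?_, ?_⟩
  · simp [hd]
  · simp [coord]
  · simp [hAB]
  · simp [hA]
  · simp [label_label_of_mem_kinematicSlice hs]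
  · simp [hiB]
  · simp [hsymm (labelB n), hAB]
  · simp [hsymm (labelB n), hiB]
  · simp [hd]

theorem ofCoord_mem_kinematicSlice {c : Fin n → Fin n → ℝ} {x : Fin n → ℝ}
    (hx : x ∈ coordHyperplane c) : ofCoord c x ∈ kinematicSlice c := by
  refine ⟨mem_kinematicSpace_iff.2 ?_, fun i j h => by simp [symmetrize, h]⟩
  rw [coordHyperplane, Set.mem_ofPred_eq] at hx
  have := sum_symmetrize c
  simp only [sum_labels, forall_labels]
  refine ⟨by simp [symmetrize], ?_, ?_⟩
  · simp [symmetrize_comm c]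
  · refine ⟨by simp, fun i => ?_, ?_⟩
    · simp only [ofCoord_label_A, ofCoord_label_label, ofCoord_label_B, Finset.sum_neg_distrib]
      ring
    simp only [ofCoord_B_A, ofCoord_B_label, ofCoord_B_B, Finset.sum_add_distrib,
      Finset.sum_neg_distrib, this, hx]
    ring

theorem coord_mem_coordHyperplane {c : Fin n → Fin n → ℝ} {s : Fin (n + 2) → Fin (n + 2) → ℝ}
    (hs : s ∈ kinematicSlice c) : coord s ∈ coordHyperplane c := by
  have hB := (mem_kinematicSpace_iff.1 hs.1).2.2 (labelB n)
  have := sum_symmetrize c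
  rw [eq_ofCoord hs] at hB
  simp only [sum_labels, ofCoord_B_A, ofCoord_B_label, ofCoord_B_B, Finset.sum_add_distrib,
    Finset.sum_neg_distrib] at hB
  rw [coordHyperplane, Set.mem_ofPred_eq]
  linarith

theorem bijOn_coord (c : Fin n → Fin n → ℝ) :
    Set.BijOn coord (kinematicSlice c) (coordHyperplane c) := by
  refine ⟨fun s hs => coord_mem_coordHyperplane hs, fun s hs t ht h => ?_, fun x hx => ?_⟩
  · rw [eq_ofCoord hs, eq_ofCoord ht, h]
  · exact ⟨_, ofCoord_mem_kinematicSlice hx, funext fun i => ofCoord_A_label c x i⟩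

end Kinematic

/-- The first two conjuncts say that the coordinates `x_i = s_{ai}` identify the slice with an
affine hyperplane of `ℝⁿ` that contains the zonotope; the third one is the alternating sum. -/
theorem mainTheorem3 (n : ℕ) (c : Fin n → Fin n → ℝ) (hc : ∀ i j, i < j → 0 ≤ c i j) :
    Set.BijOn Kinematic.coord (Kinematic.kinematicSlice c) (Kinematic.coordHyperplane c) ∧
    Kinematic.zonotope c ⊆ Kinematic.coordHyperplane c ∧
    ∀ s : Fin (n + 2) → Fin (n + 2) → ℝ,
      (Kinematic.kinematicZonotope c).indicator (fun _ => (1 : ℤ)) s =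
        ∑ T : Kinematic.OrderedSetPartition n,
          (-1 : ℤ) ^ (n - T.len) * (Kinematic.flagCone c T).indicator (fun _ => (1 : ℤ)) s := by
  classical
  refine ⟨Kinematic.bijOn_coord c,
    fun x hx => (Kinematic.excess_nonneg_of_mem_zonotope hc hx).1, fun s => ?_⟩
  simp only [Set.indicator_apply]
  by_cases hs : s ∈ Kinematic.kinematicSlice c
  · have hH := Kinematic.coord_mem_coordHyperplane hs
    have h1 := (excess_univ_eq_zero_iff _).2 hH
    have hcone (T : Kinematic.OrderedSetPartition n) : s ∈ Kinematic.flagCone c T ↔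
        ∀ m, 1 ≤ m → m < T.len → 0 ≤ excess c (Kinematic.coord s) (T.initialUnion m) := by
      simp [Kinematic.flagCone, Kinematic.mandelstam_withA hs, hs, h1]
    have hzon : s ∈ Kinematic.kinematicZonotope c ↔
        ∀ J, 0 ≤ excess c (Kinematic.coord s) J :=
      ⟨fun h => (Kinematic.excess_nonneg_of_mem_zonotope hc h.2).2,
        fun h => ⟨hs, Kinematic.mem_zonotope_of_excess_nonneg h hH⟩⟩
    simp only [hcone, hzon]
    rw [sum_orderedSetPartition (fun J => 0 ≤ excess c (Kinematic.coord s) J) h1.ge,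
      chainSum_submodular _ (excess_union_add_inter_le hc _) (excess_empty _)]
  · rw [if_neg fun h => hs h.1]
    simp [Kinematic.flagCone, hs]
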